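/- **Setting.** Let $1\le p<\infty$. Let $(\Omega,d)$ be an unbounded, locally compact, non-complete metric space with completion $\overline\Omega$, let $\partial\Omega=\overline\Omega\setminus\Omega$ be bounded, and put $d_\Omega(x)=\operatorname{dist}(x,\partial\Omega)$. Assume that $\Omega$ is uniform: there is $C_U\ge1$ such that any two distinct points $x,y\in\Omega$ are the end points of a curve $\gamma$ in $\Omega$ of length at most $C_U\,d(x,y)$ with $\min\{\ell(\gamma[x,z]),\ell(\gamma[z,y])\}\le C_U\,d_\Omega(z)$ for all $z$ on $\gamma$. Let $\mu$ be a doubling Radon measure on $\Omega$ that supports a sub-Whitney $p$-Poincaré inequality: there are $A,\lambda\ge1$ and $C_P>0$ such that for all $x\in\Omega$, $0<r\le d_\Omega(x)/A$ and $u\in D^{1,p}(\Omega)$ that are integrable on $B=B(x,r)$, $$\frac1{\mu(B)}\int_B|u-u_B|\,d\mu\le C_P\,r\left(\frac1{\mu(\lambda B)}\int_{\lambda B}g_u^p\,d\mu\right)^{1/p},\qquad u_B=\frac1{\mu(B)}\int_B u\,d\mu .$$ Let $\varphi:(0,\infty)\to(0,1]$ be continuous and decreasing such that $\varphi=1$ on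 $(0,1]$; $\int_0^\infty\varphi(t)\,dt<\infty$; $\varphi(t)\le C_\varphi\varphi(2t)$ for all $t>0$; $\varphi(t)\ge\tau\varphi(2t)$ for all $t\ge1$, with some $\tau>2$; and, with some constant $C$, for all integers $m\ge1$, $$\sum_{n\ge m}2^n\varphi(2^n)\le C\,2^m\varphi(2^m),\qquad \sum_{n\ge m}\varphi(2^n)^p\mu(\Omega_n)\le C\,\varphi(2^m)^p\mu(\Omega_m),$$ where $\Omega_n=\{x\in\Omega:2^{n-1}<d_\Omega(x)\le2^n\}$. Set $$d_\varphi(x,y)=\inf_\gamma\int_\gamma\varphi\circ d_\Omega\,ds,\qquad d\mu_\varphi=(\varphi\circ d_\Omega)^p\,d\mu,$$ the infimum being over all rectifiable curves $\gamma$ in $\Omega$ from $x$ to $y$. The completion of $\Omega\cup\partial\Omega$ with respect to $d_\varphi$, with $\partial\Omega$ removed, is $\Omega_\varphi=\Omega\cup\{\infty\}$ with a single new point $\infty$; thus $(\Omega_\varphi\setminus\{\infty\},d_\varphi,\mu_\varphi)$ is the set $\Omega$ with the metric $d_\varphi$ and the measure $\mu_\varphi$. **Definitions.** Let $(U,d_U,\mu_U)$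 be one of the two metric measure spaces $(\Omega,d,\mu)$, $(\Omega_\varphi\setminus\{\infty\},d_\varphi,\mu_\varphi)$. A Borel function $g:U\to[0,\infty]$ is a $p$-weak upper gradient of $u:U\to\mathbb R$ if $|u(x)-u(y)|\le\int_\gamma g\,ds$ for all non-constant compact rectifiable curves $\gamma$ in $U$, with end points $x,y$, outside a family of $p$-modulus zero. The class $D^{1,p}(U)$ consists of the functions $u$ that have a $p$-weak upper gradient in $L^p(U)$; the one of smallest $L^p$-norm, $g_u$, is the minimal $p$-weak upper gradient of $u$. A function $u:U\to\mathbb R$ is $p$-harmonic if it is continuous, $u\in D^{1,p}(U)$, and $$\int_V g_u^p\,d\mu_U\le\int_V g_{u+v}^p\,d\mu_U$$ for every $v\in D^{1,p}(U)$ whose support $V$ is a compact subset of $U$. **Proposition.** A function $u:\Omega\to\mathbb R$ is $p$-harmonic in $(\Omega,d,\mu)$ if and only if it is $p$-harmonic in $(\Omega_\varphi\setminus\{\infty\},d_\varphi,\mu_\varphi)$. -/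

import Mathlib

open MeasureTheory Set Filter Topology
open scoped ENNReal NNReal

/-! ### Rectifiable curves and path integrals -/

/-- A compact rectifiable curve in `X`: a continuous map of finite length on a compact interval
`[a, b]`. Values of `toFun` outside `[a, b]` are irrelevant. -/
structure RectifiableCurve (X : Type*) [PseudoEMetricSpace X] where
  a : ℝ
  b : ℝ
  a_le_b : a ≤ b
  toFun : ℝ → X
  continuousOn : ContinuousOn toFun (Icc a b)
  rectifiable : eVariationOn toFun (Icc a b) ≠ ⊤

namespace RectifiableCurve

variable {X : Type*} [PseudoEMetricSpace X]

def source (γ : RectifiableCurve X) : X := γ.toFun γ.a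

def target (γ : RectifiableCurve X) : X := γ.toFun γ.b

noncomputable def length (γ : RectifiableCurve X) : ℝ≥0∞ := eVariationOn γ.toFun (Icc γ.a γ.b)

/-- The length of the piece of `γ` between the parameters `s` and `t`. -/
noncomputable def lengthBetween (γ : RectifiableCurve X) (s t : ℝ) : ℝ≥0∞ :=
  eVariationOn γ.toFun (Icc s t)

def NonConstant (γ : RectifiableCurve X) : Prop :=
  ∃ s ∈ Icc γ.a γ.b, ∃ t ∈ Icc γ.a γ.b, γ.toFun s ≠ γ.toFun t

/-- The arc-length parametrization of `γ`, a map on `[0, length γ]`. -/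
noncomputable def arcLength (γ : RectifiableCurve X) : ℝ → X :=
  naturalParameterization γ.toFun (Icc γ.a γ.b) γ.a

/-- The path integral `∫_γ h ds`. -/
noncomputable def lineIntegral (h : X → ℝ≥0∞) (γ : RectifiableCurve X) : ℝ≥0∞ :=
  ∫⁻ t in Icc 0 γ.length.toReal, h (γ.arcLength t)

end RectifiableCurve

/-! Every rectifiable curve can be reparametrized by arc length, reversed and concatenated; these
facts give the pseudometric axioms for the weighted distance below. -/

namespace RectifiableCurve

variable {X : Type*} [MetricSpace X]

lemma exists_unitSpeed (h : X → ℝ≥0∞) (γ : RectifiableCurve X) :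
    ∃ (L : ℝ) (η : ℝ → X), 0 ≤ L ∧ HasUnitSpeedOn η (Icc 0 L) ∧ η 0 = γ.source ∧
      η L = γ.target ∧ γ.lineIntegral h = ∫⁻ t in Icc 0 L, h (η t) := by
  have hbv : LocallyBoundedVariationOn γ.toFun (Icc γ.a γ.b) :=
    BoundedVariationOn.locallyBoundedVariationOn γ.rectifiable
  have ha : γ.a ∈ Icc γ.a γ.b := ⟨le_rfl, γ.a_le_b⟩
  have hb : γ.b ∈ Icc γ.a γ.b := ⟨γ.a_le_b, le_rfl⟩
  set v := variationOnFromTo γ.toFun (Icc γ.a γ.b) γ.a with hv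
  have hva : v γ.a = 0 := variationOnFromTo.self _ _ _
  have hvb : v γ.b = γ.length.toReal := by
    rw [hv, variationOnFromTo.eq_of_le _ _ γ.a_le_b, inter_self]; rfl
  have hmono : MonotoneOn v (Icc γ.a γ.b) := variationOnFromTo.monotoneOn hbv ha
  have hcont : ContinuousOn v (Icc γ.a γ.b) := by
    intro t ht
    have hc := γ.continuousOn t ht
    have h1 := variationOnFromTo.tendsto_left ha ht hbv
      (hc.mono_left (nhdsWithin_mono _ inter_subset_left))
    have h2 := variationOnFromTo.tendsto_right ha ht hbv
      (hc.mono_left (nhdsWithin_mono _ inter_subset_left))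
    rw [dist_self, sub_zero] at h1
    rw [dist_self, add_zero] at h2
    have h3 : Tendsto v (𝓝[{t}] t) (𝓝 (v t)) := by
      rw [nhdsWithin_singleton]; exact tendsto_pure_nhds v t
    have h4 := (h1.sup h2).sup h3
    rw [← nhdsWithin_union, ← nhdsWithin_union] at h4
    refine h4.mono_left (nhdsWithin_mono _ ?_)
    intro s hs
    rcases lt_trichotomy s t with h | h | h
    · exact Or.inl (Or.inl ⟨hs, h⟩)
    · exact Or.inr h
    · exact Or.inl (Or.inr ⟨hs, h⟩)
  have himg : v '' Icc γ.a γ.b = Icc 0 γ.length.toReal := by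
    apply Subset.antisymm
    · rintro _ ⟨t, ht, rfl⟩
      exact ⟨hva ▸ hmono ha ht ht.1, hvb ▸ hmono ht hb ht.2⟩
    · have := intermediate_value_Icc γ.a_le_b hcont
      rwa [hva, hvb] at this
  refine ⟨γ.length.toReal, γ.arcLength, ENNReal.toReal_nonneg, ?_, ?_, ?_, rfl⟩
  · rw [← himg]; exact has_unit_speed_naturalParameterization _ hbv ha
  · rw [← hva]; exact edist_eq_zero.1 (edist_naturalParameterization_eq_zero hbv ha ha)
  · rw [← hvb]; exact edist_eq_zero.1 (edist_naturalParameterization_eq_zero hbv ha hb)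

lemma exists_of_unitSpeed (h : X → ℝ≥0∞) {L : ℝ} (hL : 0 ≤ L) {η : ℝ → X}
    (hη : HasUnitSpeedOn η (Icc 0 L)) :
    ∃ γ : RectifiableCurve X, γ.source = η 0 ∧ γ.target = η L ∧
      γ.lineIntegral h = ∫⁻ t in Icc 0 L, h (η t) := by
  have h0 : (0 : ℝ) ∈ Icc 0 L := ⟨le_rfl, hL⟩
  have hL' : L ∈ Icc 0 L := ⟨hL, le_rfl⟩
  have hlen : eVariationOn η (Icc 0 L) = ENNReal.ofReal L := by
    have := hη h0 hL'
    simpa using this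
  have hlip : ∀ s ∈ Icc 0 L, ∀ t ∈ Icc 0 L, s ≤ t → edist (η s) (η t) ≤ ENNReal.ofReal (t - s) := by
    intro s hs t ht hst
    have h1 := hη hs ht
    rw [NNReal.coe_one, one_mul] at h1
    rw [← h1]
    exact eVariationOn.edist_le _ ⟨hs, le_rfl, hst⟩ ⟨ht, hst, le_rfl⟩
  have hc : LipschitzOnWith 1 η (Icc 0 L) := by
    intro s hs t ht
    rw [ENNReal.coe_one, one_mul, edist_dist s t, Real.dist_eq]
    rcases le_total s t with hst | hst
    · rw [abs_sub_comm, abs_of_nonneg (sub_nonneg.2 hst)]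
      exact hlip s hs t ht hst
    · rw [edist_comm, abs_of_nonneg (sub_nonneg.2 hst)]
      exact hlip t ht s hs hst
  refine ⟨⟨0, L, hL, η, hc.continuousOn, by rw [hlen]; exact ENNReal.ofReal_ne_top⟩,
    rfl, rfl, ?_⟩
  have hbv := (hasConstantSpeedOnWith_iff_variationOnFromTo_eq.1 hη)
  simp only [lineIntegral, length, arcLength, hlen, ENNReal.toReal_ofReal hL]
  refine setLIntegral_congr_fun measurableSet_Icc ?_
  intro t ht
  have hv := hbv.2 h0 ht
  rw [NNReal.coe_one, one_mul, sub_zero] at hv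
  have := edist_eq_zero.1 (edist_naturalParameterization_eq_zero hbv.1 h0 ht)
  rw [hv] at this
  simp only [this]

lemma exists_reverse (h : X → ℝ≥0∞) (γ : RectifiableCurve X) :
    ∃ γ' : RectifiableCurve X, γ'.source = γ.target ∧ γ'.target = γ.source ∧
      γ'.lineIntegral h = γ.lineIntegral h := by
  obtain ⟨L, η, hL, hη, h0, h1, hI⟩ := exists_unitSpeed h γ
  have hrev : HasUnitSpeedOn (η ∘ fun t => L - t) (Icc 0 L) := by
    refine hasConstantSpeedOnWith_iff_ordered.2 ?_
    intro s hs t ht hst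
    have hanti : AntitoneOn (fun t : ℝ => L - t) (Icc 0 L ∩ Icc s t) :=
      fun x _ y _ hxy => sub_le_sub_left hxy L
    rw [eVariationOn.comp_eq_of_antitoneOn η _ hanti]
    have himg : (fun t : ℝ => L - t) '' (Icc 0 L ∩ Icc s t) = Icc 0 L ∩ Icc (L - t) (L - s) := by
      rw [Icc_inter_Icc, Icc_inter_Icc, Set.image_const_sub_Icc]
      congr 1
      · rw [min_eq_right ht.2, max_eq_right (sub_nonneg.2 ht.2)]
      · rw [max_eq_right hs.1, min_eq_right (by linarith [hs.1])]
    rw [himg, hη ⟨by linarith [ht.2], by linarith [ht.1]⟩ ⟨by linarith [hs.2], by linarith [hs.1]⟩]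
    congr 1; ring
  obtain ⟨γ', a1, a2, a3⟩ := exists_of_unitSpeed h hL hrev
  refine ⟨γ', by simp [a1, h1], by simp [a2, h0], ?_⟩
  rw [a3, hI, ← lintegral_indicator measurableSet_Icc, ← lintegral_indicator measurableSet_Icc,
    ← lintegral_sub_left_eq_self _ L]
  refine lintegral_congr fun t => ?_
  simp only [indicator, mem_Icc, Function.comp]
  have : (0 ≤ t ∧ t ≤ L) ↔ (0 ≤ L - t ∧ L - t ≤ L) := by
    constructor <;> rintro ⟨_, _⟩ <;> constructor <;> linarith
  simp only [this, sub_sub_cancel]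

lemma exists_concat (h : X → ℝ≥0∞) (γ₁ γ₂ : RectifiableCurve X) (hγ : γ₁.target = γ₂.source) :
    ∃ γ : RectifiableCurve X, γ.source = γ₁.source ∧ γ.target = γ₂.target ∧
      γ.lineIntegral h = γ₁.lineIntegral h + γ₂.lineIntegral h := by
  obtain ⟨L, η, hL, hη, h0, h1, hI⟩ := exists_unitSpeed h γ₁
  obtain ⟨M, θ, hM, hθ, k0, k1, kI⟩ := exists_unitSpeed h γ₂
  set ζ : ℝ → X := fun t => if t ≤ L then η t else θ (t - L) with hζ
  have e1 : EqOn ζ η (Icc 0 L) := fun t ht => by simp [hζ, ht.2]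
  have e2 : EqOn ζ (θ ∘ fun t => t - L) (Icc L (L + M)) := by
    intro t ht
    rcases ht.1.eq_or_lt with rfl | hlt
    · simp [hζ, h1, k0, hγ]
    · simp [hζ, not_le.2 hlt]
  have u1 : HasUnitSpeedOn ζ (Icc 0 L) := by
    intro s hs t ht
    rw [eVariationOn.congr (e1.mono inter_subset_left)]
    exact hη hs ht
  have u2 : HasUnitSpeedOn ζ (Icc L (L + M)) := by
    refine hasConstantSpeedOnWith_iff_ordered.2 ?_
    intro s hs t ht hst
    have hm : MonotoneOn (fun t : ℝ => t - L) (Icc L (L + M) ∩ Icc s t) :=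
      fun x _ y _ hxy => sub_le_sub_right hxy L
    rw [eVariationOn.congr (e2.mono inter_subset_left), eVariationOn.comp_eq_of_monotoneOn θ _ hm]
    have himg : (fun t : ℝ => t - L) '' (Icc L (L + M) ∩ Icc s t)
        = Icc 0 M ∩ Icc (s - L) (t - L) := by
      rw [Icc_inter_Icc, Icc_inter_Icc, Set.image_sub_const_Icc]
      congr 1
      · rw [max_eq_right hs.1, max_eq_right (sub_nonneg.2 hs.1)]
      · rw [min_eq_right ht.2, min_eq_right (by linarith [ht.2])]
    rw [himg, hθ ⟨by linarith [hs.1], by linarith [hs.2]⟩ ⟨by linarith [ht.1], by linarith [ht.2]⟩]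
    congr 1; ring
  obtain ⟨γ, a1, a2, a3⟩ := exists_of_unitSpeed h (add_nonneg hL hM) (u1.Icc_Icc u2)
  refine ⟨γ, ?_, ?_, ?_⟩
  · rw [a1, e1 ⟨le_rfl, hL⟩, h0]
  · rw [a2, e2 ⟨by linarith, le_rfl⟩, ← k1]; simp
  · rw [a3, hI, kI]
    have hsplit : Icc 0 (L + M) = Icc 0 L ∪ Ioc L (L + M) :=
      (Icc_union_Ioc_eq_Icc hL (by linarith)).symm
    have hdisj : Disjoint (Icc 0 L) (Ioc L (L + M)) :=
      Set.disjoint_left.2 fun t ht ht' => absurd ht.2 (not_le.2 ht'.1)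
    rw [hsplit, lintegral_union measurableSet_Ioc hdisj]
    congr 1
    · exact setLIntegral_congr_fun measurableSet_Icc fun t ht => by simp only [e1 ht]
    · have step : ∫⁻ t in Ioc L (L + M), h (ζ t) = ∫⁻ t in Ioc L (L + M), h (θ (t - L)) :=
        setLIntegral_congr_fun measurableSet_Ioc fun t ht => by
          have := e2 (Ioc_subset_Icc_self ht)
          simp only [this, Function.comp]
      rw [step, ← setLIntegral_congr (Ioc_ae_eq_Icc (a := (0 : ℝ)) (b := M)),
        ← lintegral_indicator measurableSet_Ioc, ← lintegral_indicator measurableSet_Ioc,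
        ← lintegral_sub_right_eq_self ((Ioc 0 M).indicator fun t => h (θ t)) L]
      refine lintegral_congr fun t => ?_
      simp only [indicator, mem_Ioc]
      have : (0 < t - L ∧ t - L ≤ M) ↔ (L < t ∧ t ≤ L + M) := by
        constructor <;> rintro ⟨_, _⟩ <;> constructor <;> linarith
      simp only [this]

lemma exists_const (h : X → ℝ≥0∞) (x : X) :
    ∃ γ : RectifiableCurve X, γ.source = x ∧ γ.target = x ∧ γ.lineIntegral h = 0 := by
  obtain ⟨γ, a1, a2, a3⟩ := exists_of_unitSpeed h (le_refl (0 : ℝ)) (η := fun _ => x)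
    (hasConstantSpeedOnWith_of_subsingleton _ (by simp) _)
  exact ⟨γ, a1, a2, by rw [a3]; simp⟩

end RectifiableCurve

/-- The weighted distance: the infimum of `∫_γ h ds` over the rectifiable curves from `x` to `y`
(it is `∞` if there are none). -/
noncomputable def weightedEDist {X : Type*} [PseudoEMetricSpace X] (h : X → ℝ≥0∞) (x y : X) :
    ℝ≥0∞ :=
  ⨅ (γ : RectifiableCurve X) (_ : γ.source = x) (_ : γ.target = y), γ.lineIntegral h

section weightedEDist

variable {X : Type*} [MetricSpace X] (h : X → ℝ≥0∞)

lemma weightedEDist_self (x : X) : weightedEDist h x x = 0 := by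
  obtain ⟨γ, h1, h2, h3⟩ := RectifiableCurve.exists_const h x
  exact le_antisymm (h3 ▸ iInf_le_of_le γ (iInf₂_le h1 h2)) bot_le

lemma weightedEDist_comm_le (x y : X) : weightedEDist h x y ≤ weightedEDist h y x := by
  refine le_iInf fun γ => le_iInf fun h1 => le_iInf fun h2 => ?_
  obtain ⟨γ', k1, k2, k3⟩ := γ.exists_reverse h
  exact k3 ▸ iInf_le_of_le γ' (iInf₂_le (k1.trans h2) (k2.trans h1))

lemma weightedEDist_triangle (x y z : X) :
    weightedEDist h x z ≤ weightedEDist h x y + weightedEDist h y z := by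
  unfold weightedEDist
  simp only [ENNReal.iInf_add, ENNReal.add_iInf]
  refine le_iInf fun γ₂ => le_iInf fun b1 => le_iInf fun b2 => le_iInf fun γ₁ =>
    le_iInf fun a1 => le_iInf fun a2 => ?_
  obtain ⟨γ, k1, k2, k3⟩ := γ₁.exists_concat h γ₂ (a2.trans b1.symm)
  exact k3 ▸ iInf_le_of_le γ (iInf₂_le (k1.trans a1) (k2.trans b2))

end weightedEDist

/-! ### Upper gradients and `p`-harmonic functions

`X` is a metric space with a measure `μ`. Borel measurability always refers to the Borel
`σ`-algebra of the metric of `X`. -/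

section Harmonic

variable {X : Type*} [PseudoEMetricSpace X] [MeasurableSpace X]

/-- The `p`-modulus of a family of curves. -/
noncomputable def modulus (p : ℝ) (μ : Measure X) (Γ : Set (RectifiableCurve X)) : ℝ≥0∞ :=
  ⨅ (ρ : X → ℝ≥0∞) (_ : Measurable[borel X] ρ) (_ : ∀ γ ∈ Γ, 1 ≤ γ.lineIntegral ρ),
    ∫⁻ x, ρ x ^ p ∂μ

/-- `g` is a `p`-weak upper gradient of `u`: it is a Borel function with values in `[0, ∞]`, and
`|u(y) - u(x)| ≤ ∫_γ g ds`, with `x`, `y` the end points of `γ`, for all non-constant compact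
rectifiable curves `γ` outside a family of `p`-modulus zero. -/
def IsWeakUpperGradient (p : ℝ) (μ : Measure X) (u : X → ℝ) (g : X → ℝ≥0∞) : Prop :=
  Measurable[borel X] g ∧
    modulus p μ {γ | γ.NonConstant ∧
      ¬ ENNReal.ofReal |u γ.target - u γ.source| ≤ γ.lineIntegral g} = 0

/-- The Dirichlet-Sobolev class `D^{1,p}(X, μ)`. -/
def MemDirichlet (p : ℝ) (μ : Measure X) (u : X → ℝ) : Prop :=
  ∃ g, IsWeakUpperGradient p μ u g ∧ ∫⁻ x, g x ^ p ∂μ < ⊤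

/-- `g` is (a Borel representative of) the minimal `p`-weak upper gradient of `u`, that is, a
`p`-weak upper gradient in `L^p` of smallest `L^p`-norm. -/
structure IsMinimalWeakUpperGradient (p : ℝ) (μ : Measure X) (u : X → ℝ) (g : X → ℝ≥0∞) :
    Prop where
  isWeakUpperGradient : IsWeakUpperGradient p μ u g
  energy_lt_top : ∫⁻ x, g x ^ p ∂μ < ⊤
  energy_le : ∀ h, IsWeakUpperGradient p μ u h → ∫⁻ x, g x ^ p ∂μ ≤ ∫⁻ x, h x ^ p ∂μ

/-- `u ∈ D^{1,p}` is a `p`-minimizer if `∫_V g_u^p dμ ≤ ∫_V g_{u+v}^p dμ` for every `v ∈ D^{1,p}`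
with compact support `V`. A function in `D^{1,p}` has a minimal `p`-weak upper gradient, unique
up to a null set, so the choice of the representatives `g` and `h` plays no role. -/
structure IsPMinimizer (p : ℝ) (μ : Measure X) (u : X → ℝ) : Prop where
  memDirichlet : MemDirichlet p μ u
  energy_le : ∀ v : X → ℝ, MemDirichlet p μ v → HasCompactSupport v → ∀ g h : X → ℝ≥0∞,
    IsMinimalWeakUpperGradient p μ u g → IsMinimalWeakUpperGradient p μ (u + v) h →
      ∫⁻ x in tsupport v, g x ^ p ∂μ ≤ ∫⁻ x in tsupport v, h x ^ p ∂μ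

/-- A `p`-harmonic function is a continuous `p`-minimizer. -/
def IsPHarmonic (p : ℝ) (μ : Measure X) (u : X → ℝ) : Prop :=
  Continuous u ∧ IsPMinimizer p μ u

end Harmonic

/-! ### The domain: boundary, uniformity, doubling and the Poincaré inequality -/

section Domain

variable (Ω : Type*) [MetricSpace Ω]

/-- The boundary of `Ω` in its completion. -/
def domainBoundary : Set (UniformSpace.Completion Ω) :=
  (Set.range ((↑) : Ω → UniformSpace.Completion Ω))ᶜ

variable {Ω}

/-- The distance `d_Ω(x)` from `x` to the boundary of `Ω`. -/
noncomputable def distBoundary (x : Ω) : ℝ :=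
  Metric.infDist (x : UniformSpace.Completion Ω) (domainBoundary Ω)

variable (Ω)

/-- `Ω` is a uniform domain in its completion. -/
def IsUniformDomain : Prop :=
  ∃ C : ℝ, 1 ≤ C ∧ ∀ x y : Ω, x ≠ y → ∃ γ : RectifiableCurve Ω,
    γ.source = x ∧ γ.target = y ∧ γ.length ≤ ENNReal.ofReal (C * dist x y) ∧
    ∀ t ∈ Icc γ.a γ.b, min (γ.lengthBetween γ.a t) (γ.lengthBetween t γ.b) ≤
      ENNReal.ofReal (C * distBoundary (γ.toFun t))

variable {Ω} [MeasurableSpace Ω]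

/-- `μ` is doubling, with balls of positive and finite measure. -/
def IsDoubling (μ : Measure Ω) : Prop :=
  ∃ C : ℝ≥0, ∀ (x : Ω) (r : ℝ), 0 < r →
    0 < μ (Metric.ball x (2 * r)) ∧
      μ (Metric.ball x (2 * r)) ≤ C * μ (Metric.ball x r) ∧ μ (Metric.ball x r) < ⊤

/-- The sub-Whitney `p`-Poincaré inequality: a `p`-Poincaré inequality on the balls `B(x, r)` with
`0 < r ≤ d_Ω(x) / A`. It is asked only of functions in `D^{1,p}` that are integrable on `B(x, r)`, so
that the mean value over the ball is meaningful. -/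
def SubWhitneyPoincare (p : ℝ) (μ : Measure Ω) : Prop :=
  ∃ A C lam : ℝ, 1 ≤ A ∧ 0 < C ∧ 1 ≤ lam ∧
    ∀ (x : Ω) (r : ℝ), 0 < r → r ≤ distBoundary x / A →
    ∀ (u : Ω → ℝ) (g : Ω → ℝ≥0∞), IntegrableOn u (Metric.ball x r) μ →
      IsMinimalWeakUpperGradient p μ u g →
      ⨍⁻ y in Metric.ball x r, ENNReal.ofReal |u y - ⨍ z in Metric.ball x r, u z ∂μ| ∂μ ≤
        ENNReal.ofReal (C * r) * (⨍⁻ y in Metric.ball x (lam * r), g y ^ p ∂μ) ^ (1 / p)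

/-- The band `Ω_n = {x ∈ Ω : 2^(n-1) < d_Ω(x) ≤ 2^n}`, for `n ≥ 1`. -/
def band (Ω : Type*) [MetricSpace Ω] (n : ℕ) : Set Ω :=
  {x | (2 : ℝ) ^ ((n : ℤ) - 1) < distBoundary x ∧ distBoundary x ≤ (2 : ℝ) ^ n}

/-- The dampening functions `φ : (0, ∞) → (0, 1]`; the values of `φ` on `(-∞, 0]` play no role.
In the last two conditions the sums run over `n = m + k`, `k ≥ 0`. -/
structure IsDampening (p : ℝ) (μ : Measure Ω) (φ : ℝ → ℝ) : Prop where
  pos : ∀ t, 0 < t → 0 < φ t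
  le_one : ∀ t, 0 < t → φ t ≤ 1
  antitoneOn : AntitoneOn φ (Ioi 0)
  continuousOn : ContinuousOn φ (Ioi 0)
  eq_one : ∀ t, 0 < t → t ≤ 1 → φ t = 1
  integrableOn : IntegrableOn φ (Ioi 0)
  reverse_doubling : ∃ C : ℝ, 1 ≤ C ∧ ∀ t, 0 < t → φ t ≤ C * φ (2 * t)
  decay : ∃ τ : ℝ, 2 < τ ∧ ∀ t, 1 ≤ t → τ * φ (2 * t) ≤ φ t
  tsum_le : ∃ C : ℝ≥0, ∀ m : ℕ, 1 ≤ m →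
    ∑' k : ℕ, ENNReal.ofReal (2 ^ (m + k) * φ (2 ^ (m + k))) ≤
      C * ENNReal.ofReal (2 ^ m * φ (2 ^ m))
  tsum_measure_le : ∃ C : ℝ≥0, ∀ m : ℕ, 1 ≤ m →
    ∑' k : ℕ, ENNReal.ofReal (φ (2 ^ (m + k))) ^ p * μ (band Ω (m + k)) ≤
      C * (ENNReal.ofReal (φ (2 ^ m)) ^ p * μ (band Ω m))

end Domain

/-! ### The transformed metric measure space -/

section Transformed

variable (Ω : Type*) [MetricSpace Ω] (φ : ℝ → ℝ)

/-- The weight `φ ∘ d_Ω`. -/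
noncomputable def dampingWeight (x : Ω) : ℝ≥0∞ := ENNReal.ofReal (φ (distBoundary x))

/-- The set `Ω`, equipped with the distance `d_φ` in place of `d`. For the domains and the functions `φ`
considered here `d_φ` is a metric, and this metric space is `Ω_φ ∖ {∞}`. -/
def Transformed (_φ : ℝ → ℝ) : Type _ := Ω

/-- The identity map from `Ω` to `Ω` equipped with `d_φ`. -/
def toTransformed : Ω ≃ Transformed Ω φ := Equiv.refl Ω

/-- The distance `d_φ(x, y) = inf_γ ∫_γ φ ∘ d_Ω ds`, the infimum being over the `d`-rectifiable
curves in `Ω` from `x` to `y`. -/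
noncomputable instance : PseudoEMetricSpace (Transformed Ω φ) where
  edist x y := weightedEDist (dampingWeight Ω φ) ((toTransformed Ω φ).symm x)
    ((toTransformed Ω φ).symm y)
  edist_self _ := weightedEDist_self _ _
  edist_comm _ _ := le_antisymm (weightedEDist_comm_le _ _ _) (weightedEDist_comm_le _ _ _)
  edist_triangle _ _ _ := weightedEDist_triangle _ _ _ _

instance [m : MeasurableSpace Ω] : MeasurableSpace (Transformed Ω φ) := m

/-- The measure `dμ_φ = φ(d_Ω(x))^p dμ`, on `Ω` equipped with `d_φ`. -/
noncomputable def transformedMeasure [MeasurableSpace Ω] (p : ℝ) (μ : Measure Ω) :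
    Measure (Transformed Ω φ) :=
  (μ.withDensity fun x => dampingWeight Ω φ x ^ p).map (toTransformed Ω φ)

end Transformed

/-!
The transformed space is obtained from `(Ω, d, μ)` by a conformal change with the continuous positive
weight `w = φ ∘ d_Ω`: lengths are multiplied by `w` and the measure by `w ^ p`. Both effects cancel in
the `p`-energy, so `p`-harmonicity is the same notion on the two sides.

In detail, `w` is close to a constant near each point of `Ω`, and hence so is the ratio of the
`d_φ`-length to the `d`-length of short curves. Together with `d_φ ≤ C d`, which follows from
`φ ≤ 1` and the quasiconvexity contained in uniformity, this shows that the two spaces have the same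
topology (`IsConformalWeight.homeomorph`) and the same compact rectifiable curves
(`IsConformalWeight.mapCurve`, `IsConformalWeight.comapCurve`). Along a curve `η` parametrized by
`d`-arc length, the `d_φ`-length of the initial pieces has the derivative `w ∘ η`
(`IsConformalWeight.hasDerivWithinAt_transformedLength`), and a change of variables gives
`∫_γ h ds_φ = ∫_γ w h ds` (`IsConformalWeight.lineIntegral_mapCurve`).

Consequently `h` is a `p`-weak upper gradient in the transformed space if and only if `w h` is one in
`Ω`: path integrals agree, and so do the moduli of curve families, because
`∫ h ^ p dμ_φ = ∫ (w h) ^ p dμ` (`IsConformalWeight.setLIntegral_transformedMeasure`). The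
correspondence `h ↦ w h` is bijective as `w` is positive and finite. It preserves energies over
every Borel set, hence minimal `p`-weak upper gradients, the class `D^{1,p}` and the minimization
property. Positivity of `w` holds since a locally compact space is open in its completion, so that
`d_Ω > 0`.
-/

/-! ### Rectifiable curves and their arc-length parametrization -/

/-- A comparison of the distances between image points passes to the variations; the two factors
make it usable in both directions without dividing in `ℝ≥0∞`. -/
lemma mul_eVariationOn_le_mul_eVariationOn {α E F : Type*} [LinearOrder α] [PseudoEMetricSpace E]
    [PseudoEMetricSpace F] {f : α → E} {g : α → F} {S : Set α} {a b : ℝ≥0∞}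
    (h : ∀ s ∈ S, ∀ t ∈ S, a * edist (f s) (f t) ≤ b * edist (g s) (g t)) :
    a * eVariationOn f S ≤ b * eVariationOn g S := by
  rw [eVariationOn, ENNReal.mul_iSup]
  refine iSup_le fun ⟨n, u, hu, hS⟩ => ?_
  refine le_trans ?_ (mul_le_mul_right (eVariationOn.sum_le (f := g) (n := n) hu hS) b)
  simp only [Finset.mul_sum]
  exact Finset.sum_le_sum fun i _ => h _ (hS _) _ (hS _)

namespace RectifiableCurve

section PseudoEMetricSpace

variable {X : Type*} [PseudoEMetricSpace X] (γ : RectifiableCurve X)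

/-- The length of the piece of `γ` between the starting point and the parameter `t`. -/
noncomputable def lengthTo : ℝ → ℝ := variationOnFromTo γ.toFun (Icc γ.a γ.b) γ.a

lemma length_ne_top : γ.length ≠ ⊤ := γ.rectifiable

lemma left_mem : γ.a ∈ Icc γ.a γ.b := ⟨le_rfl, γ.a_le_b⟩

lemma right_mem : γ.b ∈ Icc γ.a γ.b := ⟨γ.a_le_b, le_rfl⟩

lemma locallyBoundedVariationOn : LocallyBoundedVariationOn γ.toFun (Icc γ.a γ.b) :=
  BoundedVariationOn.locallyBoundedVariationOn γ.rectifiable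

lemma monotoneOn_lengthTo : MonotoneOn γ.lengthTo (Icc γ.a γ.b) :=
  variationOnFromTo.monotoneOn γ.locallyBoundedVariationOn γ.left_mem

lemma lengthTo_left : γ.lengthTo γ.a = 0 := variationOnFromTo.self _ _ _

lemma lengthTo_right : γ.lengthTo γ.b = γ.length.toReal := by
  rw [lengthTo, variationOnFromTo.eq_of_le _ _ γ.a_le_b, inter_self]; rfl

lemma lengthTo_eq {t : ℝ} (ht : t ∈ Icc γ.a γ.b) :
    γ.lengthTo t = (eVariationOn γ.toFun (Icc γ.a t)).toReal := by
  rw [lengthTo, variationOnFromTo.eq_of_le _ _ ht.1,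
    inter_eq_self_of_subset_right (Icc_subset_Icc_right ht.2)]

/-- In a pseudometric space the arc-length parametrization follows `γ` only up to distance zero,
since it is defined by a choice of parameters. -/
lemma edist_arcLength_lengthTo {t : ℝ} (ht : t ∈ Icc γ.a γ.b) :
    edist (γ.arcLength (γ.lengthTo t)) (γ.toFun t) = 0 :=
  edist_naturalParameterization_eq_zero γ.locallyBoundedVariationOn γ.left_mem ht

lemma edist_source_target_le_length : edist γ.source γ.target ≤ γ.length :=
  eVariationOn.edist_le _ γ.left_mem γ.right_mem

end PseudoEMetricSpace

variable {X : Type*} [MetricSpace X] (γ : RectifiableCurve X)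

lemma arcLength_lengthTo {t : ℝ} (ht : t ∈ Icc γ.a γ.b) :
    γ.arcLength (γ.lengthTo t) = γ.toFun t :=
  edist_eq_zero.1 (γ.edist_arcLength_lengthTo ht)

lemma continuousOn_lengthTo : ContinuousOn γ.lengthTo (Icc γ.a γ.b) := by
  intro t ht
  have hc := γ.continuousOn t ht
  have h1 := variationOnFromTo.tendsto_left γ.left_mem ht γ.locallyBoundedVariationOn
    (hc.mono_left (nhdsWithin_mono _ inter_subset_left))
  have h2 := variationOnFromTo.tendsto_right γ.left_mem ht γ.locallyBoundedVariationOn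
    (hc.mono_left (nhdsWithin_mono _ inter_subset_left))
  rw [dist_self, sub_zero] at h1
  rw [dist_self, add_zero] at h2
  have h3 : Tendsto γ.lengthTo (𝓝[{t}] t) (𝓝 (γ.lengthTo t)) := by
    rw [nhdsWithin_singleton]; exact tendsto_pure_nhds _ t
  have h4 := (h1.sup h2).sup h3
  rw [← nhdsWithin_union, ← nhdsWithin_union] at h4
  refine h4.mono_left (nhdsWithin_mono _ ?_)
  intro s hs
  rcases lt_trichotomy s t with h | h | h
  · exact Or.inl (Or.inl ⟨hs, h⟩)
  · exact Or.inr h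
  · exact Or.inl (Or.inr ⟨hs, h⟩)

lemma lengthTo_image_Icc {t : ℝ} (ht : t ∈ Icc γ.a γ.b) :
    γ.lengthTo '' Icc γ.a t = Icc 0 (γ.lengthTo t) := by
  have hsub : Icc γ.a t ⊆ Icc γ.a γ.b := Icc_subset_Icc_right ht.2
  apply Subset.antisymm
  · rintro _ ⟨s, hs, rfl⟩
    exact ⟨γ.lengthTo_left ▸ γ.monotoneOn_lengthTo γ.left_mem (hsub hs) hs.1,
      γ.monotoneOn_lengthTo (hsub hs) ht hs.2⟩
  · have := intermediate_value_Icc ht.1 (γ.continuousOn_lengthTo.mono hsub)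
    rwa [γ.lengthTo_left] at this

lemma lengthTo_image : γ.lengthTo '' Icc γ.a γ.b = Icc 0 γ.length.toReal := by
  rw [γ.lengthTo_image_Icc γ.right_mem, γ.lengthTo_right]

lemma hasUnitSpeedOn_arcLength : HasUnitSpeedOn γ.arcLength (Icc 0 γ.length.toReal) := by
  rw [← γ.lengthTo_image]
  exact has_unit_speed_naturalParameterization _ γ.locallyBoundedVariationOn γ.left_mem

lemma eVariationOn_arcLength {s t : ℝ} (hs : s ∈ Icc 0 γ.length.toReal)
    (ht : t ∈ Icc 0 γ.length.toReal) :
    eVariationOn γ.arcLength (Icc s t) = ENNReal.ofReal (t - s) := by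
  have := γ.hasUnitSpeedOn_arcLength hs ht
  rwa [inter_eq_self_of_subset_right (Icc_subset_Icc hs.1 ht.2), NNReal.coe_one, one_mul] at this

lemma lipschitzOnWith_arcLength : LipschitzOnWith 1 γ.arcLength (Icc 0 γ.length.toReal) := by
  have key : ∀ s ∈ Icc 0 γ.length.toReal, ∀ t ∈ Icc 0 γ.length.toReal, s ≤ t →
      edist (γ.arcLength s) (γ.arcLength t) ≤ ENNReal.ofReal (t - s) := fun s hs t ht hst => by
    rw [← γ.eVariationOn_arcLength hs ht]
    exact eVariationOn.edist_le _ ⟨le_rfl, hst⟩ ⟨hst, le_rfl⟩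
  intro s hs t ht
  rw [ENNReal.coe_one, one_mul, edist_dist s t, Real.dist_eq]
  rcases le_total s t with hst | hst
  · rw [abs_sub_comm, abs_of_nonneg (sub_nonneg.2 hst)]
    exact key s hs t ht hst
  · rw [edist_comm, abs_of_nonneg (sub_nonneg.2 hst)]
    exact key t ht s hs hst

lemma arcLength_zero : γ.arcLength 0 = γ.source := by
  rw [← γ.lengthTo_left, γ.arcLength_lengthTo γ.left_mem]; rfl

lemma lineIntegral_le_mul_length {h : X → ℝ≥0∞} {c : ℝ≥0∞}
    (hc : ∀ t ∈ Icc γ.a γ.b, h (γ.toFun t) ≤ c) : γ.lineIntegral h ≤ c * γ.length := by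
  have hle : γ.lineIntegral h ≤ ∫⁻ _ in Icc 0 γ.length.toReal, c := by
    refine setLIntegral_mono' measurableSet_Icc fun s hs => ?_
    rw [← γ.lengthTo_image] at hs
    obtain ⟨t, ht, rfl⟩ := hs
    rw [γ.arcLength_lengthTo ht]
    exact hc t ht
  refine hle.trans_eq ?_
  rw [setLIntegral_const, Real.volume_Icc, sub_zero, ENNReal.ofReal_toReal γ.length_ne_top]

/-- A curve spends at least the length `min (length γ) r` in the closed `r`-ball about its starting
point. -/
lemma mul_min_length_le_lineIntegral {h : X → ℝ≥0∞} {c : ℝ≥0∞} {r : ℝ}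
    (hc : ∀ y, dist y γ.source ≤ r → c ≤ h y) :
    c * min γ.length (ENNReal.ofReal r) ≤ γ.lineIntegral h := by
  set m := min γ.length.toReal r
  have hm : ENNReal.ofReal m = min γ.length (ENNReal.ofReal r) := by
    rw [ENNReal.ofReal_min, ENNReal.ofReal_toReal γ.length_ne_top]
  calc c * min γ.length (ENNReal.ofReal r) = ∫⁻ _ in Icc 0 m, c := by
        rw [setLIntegral_const, Real.volume_Icc, sub_zero, hm]
    _ ≤ ∫⁻ t in Icc 0 m, h (γ.arcLength t) := by
        refine setLIntegral_mono' measurableSet_Icc fun s hs => hc _ ?_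
        have := γ.lipschitzOnWith_arcLength.dist_le_mul s ⟨hs.1, hs.2.trans (min_le_left _ _)⟩
          0 ⟨le_rfl, ENNReal.toReal_nonneg⟩
        rw [γ.arcLength_zero, Real.dist_eq, sub_zero, abs_of_nonneg hs.1, NNReal.coe_one,
          one_mul] at this
        exact this.trans (hs.2.trans (min_le_right _ _))
    _ ≤ γ.lineIntegral h :=
        lintegral_mono_set (Icc_subset_Icc_right (min_le_left _ _))

end RectifiableCurve

/-! ### The topology of the transformed space -/

/-- What the comparison of `Ω` with the transformed space uses of the weight `φ ∘ d_Ω`: it is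
continuous and positive, and `d_φ` is bounded by a multiple of `d`. -/
structure IsConformalWeight (Ω : Type*) [MetricSpace Ω] (φ : ℝ → ℝ) : Prop where
  continuous : Continuous (dampingWeight Ω φ)
  pos : ∀ x, 0 < dampingWeight Ω φ x
  lipschitz : ∃ C : ℝ≥0, LipschitzWith C (toTransformed Ω φ)

section Conformal

variable {Ω : Type*} [MetricSpace Ω] {φ : ℝ → ℝ}

lemma dampingWeight_ne_top (x : Ω) : dampingWeight Ω φ x ≠ ⊤ := ENNReal.ofReal_ne_top

lemma edist_toTransformed (x y : Ω) : edist (toTransformed Ω φ x) (toTransformed Ω φ y) =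
    weightedEDist (dampingWeight Ω φ) x y := rfl

lemma edist_toTransformed_le_lineIntegral (γ : RectifiableCurve Ω) :
    edist (toTransformed Ω φ γ.source) (toTransformed Ω φ γ.target) ≤
      γ.lineIntegral (dampingWeight Ω φ) := by
  rw [edist_toTransformed]
  exact iInf_le_of_le γ (iInf_le_of_le rfl (iInf_le _ rfl))

lemma mul_min_edist_le_edist_toTransformed {x : Ω} {c : ℝ≥0∞} {r : ℝ}
    (hc : ∀ z, dist z x ≤ r → c ≤ dampingWeight Ω φ z) (y : Ω) :
    c * min (edist x y) (ENNReal.ofReal r) ≤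
      edist (toTransformed Ω φ x) (toTransformed Ω φ y) := by
  rw [edist_toTransformed]
  refine le_iInf fun γ => le_iInf fun h1 => le_iInf fun h2 => ?_
  subst h1 h2
  refine le_trans ?_ (γ.mul_min_length_le_lineIntegral hc)
  gcongr
  exact γ.edist_source_target_le_length

namespace IsConformalWeight

variable (hw : IsConformalWeight Ω φ)

include hw

lemma exists_forall_dist_le {x : Ω} {c : ℝ≥0∞} (hc : c < dampingWeight Ω φ x) :
    ∃ r > 0, ∀ z, dist z x ≤ r → c ≤ dampingWeight Ω φ z := by
  obtain ⟨r, hr, h⟩ := Metric.nhds_basis_closedBall.mem_iff.1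
    (hw.continuous.continuousAt.eventually_const_lt hc)
  exact ⟨r, hr, fun z hz => le_of_lt (h hz)⟩

/-- Below the value of the weight at `x`, the two distances compare near `x` by that factor. -/
lemma exists_nhds_mul_edist_le {x : Ω} {c : ℝ≥0∞} (hc : c < dampingWeight Ω φ x) :
    ∃ U ∈ 𝓝 x, ∀ y ∈ U, ∀ z ∈ U,
      c * edist y z ≤ edist (toTransformed Ω φ y) (toTransformed Ω φ z) := by
  obtain ⟨r, hr, h⟩ := hw.exists_forall_dist_le hc
  refine ⟨Metric.ball x (r / 3), Metric.ball_mem_nhds _ (by positivity), fun y hy z hz => ?_⟩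
  rw [Metric.mem_ball] at hy hz
  have hyz : dist y z ≤ 2 * r / 3 := by
    have := dist_triangle_right y z x
    linarith
  have key := mul_min_edist_le_edist_toTransformed (φ := φ) (x := y) (r := 2 * r / 3) (c := c)
    (fun w hwy => h w (by have := dist_triangle w y x; linarith)) z
  rwa [min_eq_left] at key
  rw [edist_dist]
  exact ENNReal.ofReal_le_ofReal hyz

lemma exists_nhds_lineIntegral_le {x : Ω} {c : ℝ≥0∞} (hc : dampingWeight Ω φ x < c) :
    ∃ U ∈ 𝓝 x, ∀ γ : RectifiableCurve Ω, (∀ t ∈ Icc γ.a γ.b, γ.toFun t ∈ U) →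
      edist (toTransformed Ω φ γ.source) (toTransformed Ω φ γ.target) ≤ c * γ.length :=
  ⟨_, hw.continuous.continuousAt.eventually_lt_const hc, fun γ hγ =>
    (edist_toTransformed_le_lineIntegral γ).trans
      (γ.lineIntegral_le_mul_length fun t ht => le_of_lt (hγ t ht))⟩

lemma continuous_toTransformed : Continuous (toTransformed Ω φ) := by
  obtain ⟨C, hC⟩ := hw.lipschitz
  exact hC.continuous

lemma continuous_toTransformed_symm : Continuous (toTransformed Ω φ).symm := by
  refine continuous_iff_continuousAt.2 fun x => ?_
  obtain ⟨x, rfl⟩ := (toTransformed Ω φ).surjective x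
  obtain ⟨c, hc0, hc⟩ := exists_between (hw.pos x)
  obtain ⟨r, hr, h⟩ := hw.exists_forall_dist_le hc
  have hcT : c ≠ ⊤ := (hc.trans_le le_top).ne
  refine EMetric.tendsto_nhds.2 fun ε hε => ?_
  -- if `d(x, y) ≥ ε`, then `d_φ(x, y) ≥ c min(ε, r)`.
  have hδ : 0 < c * min ε (ENNReal.ofReal r) :=
    ENNReal.mul_pos hc0.ne' (lt_min hε (ENNReal.ofReal_pos.2 hr)).ne'
  filter_upwards [Metric.eball_mem_nhds _ hδ] with y hy
  obtain ⟨y, rfl⟩ := (toTransformed Ω φ).surjective y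
  rw [Metric.mem_eball, edist_comm] at hy
  have := (mul_min_edist_le_edist_toTransformed h y).trans_lt hy
  rw [ENNReal.mul_lt_mul_iff_right hc0.ne' hcT] at this
  simp only [Equiv.symm_apply_apply]
  rw [edist_comm]
  by_contra! hlt
  exact absurd this (not_lt.2 (min_le_min_right _ hlt))

/-- The identity is a homeomorphism of `Ω` onto the transformed space. -/
def homeomorph : Ω ≃ₜ Transformed Ω φ where
  toEquiv := toTransformed Ω φ
  continuous_toFun := hw.continuous_toTransformed
  continuous_invFun := hw.continuous_toTransformed_symm

lemma eq_of_edist_eq_zero {x y : Transformed Ω φ} (h : edist x y = 0) : x = y :=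
  have := hw.homeomorph.t2Space
  (EMetric.inseparable_iff.2 h).eq

/-! ### Curves in the transformed space -/

/-- A `d`-rectifiable curve, as a `d_φ`-rectifiable curve with the same parametrization. -/
def mapCurve (γ : RectifiableCurve Ω) : RectifiableCurve (Transformed Ω φ) where
  a := γ.a
  b := γ.b
  a_le_b := γ.a_le_b
  toFun := toTransformed Ω φ ∘ γ.toFun
  continuousOn := hw.continuous_toTransformed.comp_continuousOn γ.continuousOn
  rectifiable := by
    obtain ⟨C, hC⟩ := hw.lipschitz
    exact hC.comp_boundedVariationOn γ.rectifiable

/-- Near each of its points, a `d_φ`-rectifiable curve has a `d`-length bounded by a multiple of its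
`d_φ`-length; compactness of the parameter interval makes its total `d`-length finite. -/
lemma eVariationOn_symm_ne_top (γ : RectifiableCurve (Transformed Ω φ)) :
    eVariationOn ((toTransformed Ω φ).symm ∘ γ.toFun) (Icc γ.a γ.b) ≠ ⊤ := by
  set f := (toTransformed Ω φ).symm ∘ γ.toFun with hf
  have hcont : ContinuousOn f (Icc γ.a γ.b) :=
    hw.continuous_toTransformed_symm.comp_continuousOn γ.continuousOn
  have hloc : ∀ x : Ω, ∃ c : ℝ≥0∞, c ≠ 0 ∧ ∃ U : Set Ω, IsOpen U ∧ x ∈ U ∧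
      ∀ y ∈ U, ∀ z ∈ U, c * edist y z ≤ edist (toTransformed Ω φ y) (toTransformed Ω φ z) := by
    intro x
    obtain ⟨c, hc0, hc⟩ := exists_between (hw.pos x)
    obtain ⟨U, hU, h⟩ := hw.exists_nhds_mul_edist_le hc
    obtain ⟨V, hVU, hV, hx⟩ := mem_nhds_iff.1 hU
    exact ⟨c, hc0.ne', V, hV, hx, fun y hy z hz => h y (hVU hy) z (hVU hz)⟩
  choose c hc0 U hU hxU h using hloc
  obtain ⟨t, ht0, hmono, ⟨m, hm⟩, hcov⟩ := exists_monotone_Icc_subset_open_cover_Icc γ.a_le_b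
    (c := fun i : Icc γ.a γ.b => (Icc γ.a γ.b).domRestrict f ⁻¹' U (f i))
    (fun i => (hU _).preimage hcont.domRestrict)
    (fun i _ => mem_iUnion.2 ⟨i, hxU _⟩)
  have hpiece : ∀ n, eVariationOn f (Icc (t n : ℝ) (t (n + 1))) ≠ ⊤ := by
    intro n
    obtain ⟨i, hi⟩ := hcov n
    have hmem : ∀ s ∈ Icc (t n : ℝ) (t (n + 1)), f s ∈ U (f i) := fun s hs =>
      hi (a := ⟨s, (t n).2.1.trans hs.1, hs.2.trans (t (n + 1)).2.2⟩) ⟨hs.1, hs.2⟩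
    have hle := mul_eVariationOn_le_mul_eVariationOn (f := f) (g := γ.toFun) (a := c (f i)) (b := 1)
      (S := Icc (t n : ℝ) (t (n + 1))) (fun s hs s' hs' => by
        simpa [hf] using h _ _ (hmem s hs) _ (hmem s' hs'))
    have htop : 1 * eVariationOn γ.toFun (Icc (t n : ℝ) (t (n + 1))) ≠ ⊤ := by
      rw [one_mul]
      exact ne_top_of_le_ne_top γ.rectifiable
        (eVariationOn.mono _ (Icc_subset_Icc (t n).2.1 (t (n + 1)).2.2))
    intro htop'
    rw [htop', ENNReal.mul_top (hc0 _)] at hle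
    exact htop (top_le_iff.1 hle)
  have hsum := eVariationOn.sum' f (I := fun n => (t n : ℝ)) hmono (n := m)
  simp only [ht0, hm m le_rfl] at hsum
  rw [← hsum]
  exact ENNReal.sum_ne_top.2 fun n _ => hpiece n

/-- A `d_φ`-rectifiable curve, as a `d`-rectifiable curve with the same parametrization. -/
def comapCurve (γ : RectifiableCurve (Transformed Ω φ)) : RectifiableCurve Ω where
  a := γ.a
  b := γ.b
  a_le_b := γ.a_le_b
  toFun := (toTransformed Ω φ).symm ∘ γ.toFun
  continuousOn := hw.continuous_toTransformed_symm.comp_continuousOn γ.continuousOn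
  rectifiable := hw.eVariationOn_symm_ne_top γ

lemma mapCurve_comapCurve (γ : RectifiableCurve (Transformed Ω φ)) :
    hw.mapCurve (hw.comapCurve γ) = γ := rfl

end IsConformalWeight

end Conformal

/-! ### Arc length in the transformed space -/

section ArcLength

variable {Ω : Type*} [MetricSpace Ω] {φ : ℝ → ℝ}

/-- The `d_φ`-length of the initial piece of `γ` of `d`-length `s`. -/
noncomputable def RectifiableCurve.transformedLength (φ : ℝ → ℝ) (γ : RectifiableCurve Ω) :
    ℝ → ℝ :=
  variationOnFromTo (toTransformed Ω φ ∘ γ.arcLength) (Icc 0 γ.length.toReal) 0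

namespace IsConformalWeight

variable (hw : IsConformalWeight Ω φ) (γ : RectifiableCurve Ω)

include hw

lemma locallyBoundedVariationOn_comp_arcLength :
    LocallyBoundedVariationOn (toTransformed Ω φ ∘ γ.arcLength) (Icc 0 γ.length.toReal) := by
  obtain ⟨C, hC⟩ := hw.lipschitz
  exact hC.comp_locallyBoundedVariationOn γ.hasUnitSpeedOn_arcLength.hasLocallyBoundedVariationOn

lemma transformedLength_sub {s t : ℝ} (hs : s ∈ Icc 0 γ.length.toReal)
    (ht : t ∈ Icc 0 γ.length.toReal) (hst : s ≤ t) :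
    γ.transformedLength φ t - γ.transformedLength φ s =
      (eVariationOn (toTransformed Ω φ ∘ γ.arcLength) (Icc s t)).toReal := by
  have h0 : (0 : ℝ) ∈ Icc 0 γ.length.toReal := ⟨le_rfl, ENNReal.toReal_nonneg⟩
  rw [sub_eq_iff_eq_add', RectifiableCurve.transformedLength,
    ← variationOnFromTo.add (hw.locallyBoundedVariationOn_comp_arcLength γ) h0 hs ht,
    variationOnFromTo.eq_of_le _ _ hst, inter_eq_self_of_subset_right (Icc_subset_Icc hs.1 ht.2)]

/-- Near the arc-length parameter `t₀`, the ratio of `d_φ`-length to `d`-length is close to the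
weight at `t₀`. -/
lemma exists_abs_transformedLength_sub_le {t₀ : ℝ} (ht₀ : t₀ ∈ Icc 0 γ.length.toReal) {ε : ℝ}
    (hε : 0 < ε) :
    ∃ δ > 0, ∀ s ∈ Icc 0 γ.length.toReal, ∀ t ∈ Icc 0 γ.length.toReal, s ≤ t →
      |s - t₀| < δ → |t - t₀| < δ →
      |γ.transformedLength φ t - γ.transformedLength φ s -
        (t - s) * (dampingWeight Ω φ (γ.arcLength t₀)).toReal| ≤ ε * (t - s) := by
  set x := γ.arcLength t₀
  set w := (dampingWeight Ω φ x).toReal with hwdef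
  have hw0 : 0 < w := ENNReal.toReal_pos (hw.pos x).ne' (dampingWeight_ne_top x)
  have hwx : dampingWeight Ω φ x = ENNReal.ofReal w :=
    (ENNReal.ofReal_toReal (dampingWeight_ne_top x)).symm
  have hlo : ENNReal.ofReal (w - ε) < dampingWeight Ω φ x := by
    rw [hwx]; exact (ENNReal.ofReal_lt_ofReal_iff hw0).2 (by linarith)
  have hup : dampingWeight Ω φ x < ENNReal.ofReal (w + ε) := by
    rw [hwx]; exact (ENNReal.ofReal_lt_ofReal_iff (by linarith)).2 (by linarith)
  obtain ⟨U, hU, hUlo⟩ := hw.exists_nhds_mul_edist_le hlo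
  obtain ⟨V, hV, hVup⟩ := hw.exists_nhds_lineIntegral_le hup
  have hpre := γ.lipschitzOnWith_arcLength.continuousOn t₀ ht₀ (inter_mem hU hV)
  obtain ⟨δ, hδ, hball⟩ := Metric.mem_nhdsWithin_iff.1 hpre
  refine ⟨δ, hδ, fun s hs t ht hst hsδ htδ => ?_⟩
  have hsub : Icc s t ⊆ Icc 0 γ.length.toReal := Icc_subset_Icc hs.1 ht.2
  have hmem : ∀ r ∈ Icc s t, γ.arcLength r ∈ U ∩ V := fun r hr => by
    refine hball ⟨?_, hsub hr⟩
    rw [Metric.mem_ball, Real.dist_eq, abs_lt]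
    rw [abs_lt] at hsδ htδ
    exact ⟨by linarith [hr.1], by linarith [hr.2]⟩
  rw [hw.transformedLength_sub γ hs ht hst]
  have hlower := mul_eVariationOn_le_mul_eVariationOn (f := γ.arcLength)
    (g := toTransformed Ω φ ∘ γ.arcLength) (a := ENNReal.ofReal (w - ε)) (b := 1)
    (fun r hr r' hr' => by rw [one_mul]; exact hUlo _ (hmem r hr).1 _ (hmem r' hr').1)
  have key : ∀ r ∈ Icc s t, ∀ r' ∈ Icc s t, r ≤ r' →
      edist (toTransformed Ω φ (γ.arcLength r)) (toTransformed Ω φ (γ.arcLength r')) ≤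
        ENNReal.ofReal (w + ε) * edist r r' := fun r hr r' hr' hrr' => by
    have hlen := γ.eVariationOn_arcLength (hsub hr) (hsub hr')
    refine (hVup ⟨r, r', hrr', γ.arcLength, γ.lipschitzOnWith_arcLength.continuousOn.mono
      (Icc_subset_Icc (hsub hr).1 (hsub hr').2), by rw [hlen]; exact ENNReal.ofReal_ne_top⟩
      fun q hq => (hmem q ⟨hr.1.trans hq.1, hq.2.trans hr'.2⟩).2).trans_eq ?_
    rw [RectifiableCurve.length, hlen, edist_comm, edist_dist, Real.dist_eq,
      abs_of_nonneg (sub_nonneg.2 hrr')]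
  have hupper := mul_eVariationOn_le_mul_eVariationOn (f := toTransformed Ω φ ∘ γ.arcLength)
    (g := (id : ℝ → ℝ)) (a := 1) (fun r hr r' hr' => by
      rw [one_mul]
      rcases le_total r r' with h | h
      · exact key r hr r' hr' h
      · rw [edist_comm, edist_comm (id r)]
        exact key r' hr' r hr h)
  rw [γ.eVariationOn_arcLength hs ht, one_mul (eVariationOn _ _)] at hlower
  rw [eVariationOn_id_Icc, one_mul, ← ENNReal.ofReal_mul (by linarith)] at hupper
  have hfin := ne_top_of_le_ne_top ENNReal.ofReal_ne_top hupper
  have h1 := ENNReal.toReal_mono hfin hlower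
  have h2 := ENNReal.toReal_le_of_le_ofReal
    (mul_nonneg (by linarith) (sub_nonneg.2 hst)) hupper
  rw [ENNReal.toReal_mul, ENNReal.toReal_ofReal (sub_nonneg.2 hst)] at h1
  have h3 : w - ε ≤ (ENNReal.ofReal (w - ε)).toReal := by
    rw [ENNReal.toReal_ofReal']; exact le_max_left _ _
  have h4 := mul_le_mul_of_nonneg_right h3 (sub_nonneg.2 hst)
  rw [abs_le]
  constructor <;> linarith

lemma hasDerivWithinAt_transformedLength {t : ℝ} (ht : t ∈ Icc 0 γ.length.toReal) :
    HasDerivWithinAt (γ.transformedLength φ) (dampingWeight Ω φ (γ.arcLength t)).toReal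
      (Icc 0 γ.length.toReal) t := by
  rw [hasDerivWithinAt_iff_isLittleO, Asymptotics.isLittleO_iff]
  intro ε hε
  obtain ⟨δ, hδ, h⟩ := hw.exists_abs_transformedLength_sub_le γ ht hε
  filter_upwards [inter_mem_nhdsWithin _ (Metric.ball_mem_nhds t hδ)] with s hs
  have hsδ : |s - t| < δ := hs.2
  have htδ : |t - t| < δ := by simpa using hδ
  rw [Real.norm_eq_abs, Real.norm_eq_abs, smul_eq_mul]
  rcases le_total s t with hst | hst
  · rw [abs_sub_comm s t, abs_of_nonneg (sub_nonneg.2 hst)]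
    convert h s hs.1 t ht hst hsδ htδ using 1
    rw [← abs_neg]
    congr 1; ring
  · rw [abs_of_nonneg (sub_nonneg.2 hst)]
    exact h t ht s hs.1 hst htδ hsδ

lemma strictMonoOn_transformedLength :
    StrictMonoOn (γ.transformedLength φ) (Icc 0 γ.length.toReal) := by
  refine strictMonoOn_of_deriv_pos (convex_Icc _ _)
    (fun t ht => (hw.hasDerivWithinAt_transformedLength γ ht).continuousWithinAt) fun t ht => ?_
  have hd := (hw.hasDerivWithinAt_transformedLength γ (interior_subset ht)).hasDerivAt
    (mem_interior_iff_mem_nhds.1 ht)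
  rw [hd.deriv]
  exact ENNReal.toReal_pos (hw.pos _).ne' (dampingWeight_ne_top _)

lemma lengthTo_mapCurve {t : ℝ} (ht : t ∈ Icc γ.a γ.b) :
    (hw.mapCurve γ).lengthTo t = γ.transformedLength φ (γ.lengthTo t) := by
  have hsub : Icc γ.a t ⊆ Icc γ.a γ.b := Icc_subset_Icc_right ht.2
  have hst : γ.lengthTo t ∈ Icc 0 γ.length.toReal := γ.lengthTo_image ▸ mem_image_of_mem _ ht
  have h0 : γ.transformedLength φ 0 = 0 := variationOnFromTo.self _ _ _
  have heq : EqOn (hw.mapCurve γ).toFun ((toTransformed Ω φ ∘ γ.arcLength) ∘ γ.lengthTo)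
      (Icc γ.a t) := fun s hs => by
    simp only [Function.comp_apply, γ.arcLength_lengthTo (hsub hs)]; rfl
  rw [(hw.mapCurve γ).lengthTo_eq ht, ← sub_zero (γ.transformedLength φ _), ← h0,
    hw.transformedLength_sub γ ⟨le_rfl, ENNReal.toReal_nonneg⟩ hst hst.1,
    ← γ.lengthTo_image_Icc ht, ← eVariationOn.comp_eq_of_monotoneOn _ _
      (γ.monotoneOn_lengthTo.mono hsub)]
  exact congrArg _ (eVariationOn.congr heq)

/-- The change of variables `ds_φ = φ(d_Ω) ds` in path integrals. -/
lemma lineIntegral_mapCurve (h : Transformed Ω φ → ℝ≥0∞) :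
    (hw.mapCurve γ).lineIntegral h =
      γ.lineIntegral fun x => dampingWeight Ω φ x * h (toTransformed Ω φ x) := by
  have h0 : γ.transformedLength φ 0 = 0 := variationOnFromTo.self _ _ _
  have hL : (hw.mapCurve γ).length.toReal = γ.transformedLength φ γ.length.toReal := by
    rw [← RectifiableCurve.lengthTo_right, ← γ.lengthTo_right]
    exact hw.lengthTo_mapCurve γ γ.right_mem
  have hmono := hw.strictMonoOn_transformedLength γ
  have himg : γ.transformedLength φ '' Icc 0 γ.length.toReal =
      Icc 0 (hw.mapCurve γ).length.toReal := by
    apply Subset.antisymm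
    · rintro _ ⟨s, hs, rfl⟩
      rw [hL, ← h0]
      exact ⟨hmono.monotoneOn ⟨le_rfl, ENNReal.toReal_nonneg⟩ hs hs.1,
        hmono.monotoneOn hs ⟨ENNReal.toReal_nonneg, le_rfl⟩ hs.2⟩
    · have := intermediate_value_Icc ENNReal.toReal_nonneg
        fun t ht => (hw.hasDerivWithinAt_transformedLength γ ht).continuousWithinAt
      rwa [h0, ← hL] at this
  rw [RectifiableCurve.lineIntegral, RectifiableCurve.lineIntegral, ← himg,
    lintegral_image_eq_lintegral_abs_deriv_mul measurableSet_Icc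
      (fun t ht => hw.hasDerivWithinAt_transformedLength γ ht) hmono.injOn]
  refine setLIntegral_congr_fun measurableSet_Icc fun s hs => ?_
  rw [abs_of_nonneg ENNReal.toReal_nonneg, ENNReal.ofReal_toReal (dampingWeight_ne_top _)]
  congr 2
  rw [← γ.lengthTo_image] at hs
  obtain ⟨t, ht, rfl⟩ := hs
  rw [← hw.lengthTo_mapCurve γ ht, γ.arcLength_lengthTo ht]
  exact hw.eq_of_edist_eq_zero ((hw.mapCurve γ).edist_arcLength_lengthTo ht)

end IsConformalWeight

end ArcLength

/-! ### Upper gradients and energies in the transformed space -/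

lemma measurable_borel_iff {X : Type*} [TopologicalSpace X] [m : MeasurableSpace X] [BorelSpace X]
    {g : X → ℝ≥0∞} : Measurable[borel X] g ↔ Measurable g := by
  obtain rfl : m = borel X := BorelSpace.measurable_eq
  exact Iff.rfl

lemma measurable_toTransformed {Ω : Type*} [MeasurableSpace Ω] {φ : ℝ → ℝ} :
    Measurable (toTransformed Ω φ) := fun _ hs => hs

lemma measurable_toTransformed_symm {Ω : Type*} [MeasurableSpace Ω] {φ : ℝ → ℝ} :
    Measurable (toTransformed Ω φ).symm := fun _ hs => hs

section Pullback

variable {Ω : Type*} [MetricSpace Ω] {φ : ℝ → ℝ}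

/-- The density on `Ω` that gives the same path integrals with respect to `ds` as `h` with respect
to `ds_φ = φ(d_Ω) ds`. -/
noncomputable def pullbackDensity (h : Transformed Ω φ → ℝ≥0∞) (x : Ω) : ℝ≥0∞ :=
  dampingWeight Ω φ x * h (toTransformed Ω φ x)

/-- The inverse of `pullbackDensity` for a positive weight. -/
noncomputable def pushforwardDensity (φ : ℝ → ℝ) (g : Ω → ℝ≥0∞) (y : Transformed Ω φ) : ℝ≥0∞ :=
  (dampingWeight Ω φ ((toTransformed Ω φ).symm y))⁻¹ * g ((toTransformed Ω φ).symm y)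

namespace IsConformalWeight

variable (hw : IsConformalWeight Ω φ)

include hw

lemma pullbackDensity_pushforwardDensity (g : Ω → ℝ≥0∞) :
    pullbackDensity (pushforwardDensity φ g) = g := by
  funext x
  simp only [pullbackDensity, pushforwardDensity, Equiv.symm_apply_apply]
  rw [← mul_assoc, ENNReal.mul_inv_cancel (hw.pos x).ne' (dampingWeight_ne_top x), one_mul]

lemma pushforwardDensity_pullbackDensity (h : Transformed Ω φ → ℝ≥0∞) :
    pushforwardDensity φ (pullbackDensity h) = h := by
  funext y
  simp only [pullbackDensity, pushforwardDensity, Equiv.apply_symm_apply]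
  rw [← mul_assoc, ENNReal.inv_mul_cancel (hw.pos _).ne' (dampingWeight_ne_top _), one_mul]

lemma nonConstant_mapCurve (γ : RectifiableCurve Ω) :
    (hw.mapCurve γ).NonConstant ↔ γ.NonConstant := Iff.rfl

lemma lineIntegral_comapCurve (γ : RectifiableCurve (Transformed Ω φ)) (g : Ω → ℝ≥0∞) :
    (hw.comapCurve γ).lineIntegral g = γ.lineIntegral (pushforwardDensity φ g) := by
  conv_rhs => rw [← hw.mapCurve_comapCurve γ, hw.lineIntegral_mapCurve]
  congr 1
  exact (hw.pullbackDensity_pushforwardDensity g).symm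

variable [MeasurableSpace Ω] [BorelSpace Ω]

lemma borelSpace : BorelSpace (Transformed Ω φ) where
  measurable_eq := by
    refine le_antisymm (fun s hs => ?_) (fun s hs => ?_)
    · have hs' : MeasurableSet[borel Ω] ((toTransformed Ω φ) ⁻¹' s) := by
        rw [← BorelSpace.measurable_eq (α := Ω)]; exact hs
      exact hw.continuous_toTransformed_symm.borel_measurable hs'
    · have hs' := hw.continuous_toTransformed.borel_measurable hs
      rw [← BorelSpace.measurable_eq (α := Ω)] at hs'
      exact hs'

lemma measurable_pullbackDensity {h : Transformed Ω φ → ℝ≥0∞} (hh : Measurable h) :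
    Measurable (pullbackDensity h) :=
  hw.continuous.measurable.mul (hh.comp measurable_toTransformed)

lemma measurable_pushforwardDensity {g : Ω → ℝ≥0∞} (hg : Measurable g) :
    Measurable (pushforwardDensity φ g) :=
  (hw.continuous.measurable.inv.mul hg).comp measurable_toTransformed_symm

variable {p : ℝ} (hp : 0 ≤ p) (μ : Measure Ω)

include hp

/-- The factors `φ(d_Ω)^p` of the measure and of the density cancel. -/
lemma setLIntegral_transformedMeasure {h : Transformed Ω φ → ℝ≥0∞} (hh : Measurable h)
    {S : Set (Transformed Ω φ)} (hS : MeasurableSet S) :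
    ∫⁻ y in S, h y ^ p ∂transformedMeasure Ω φ p μ =
      ∫⁻ x in toTransformed Ω φ ⁻¹' S, pullbackDensity h x ^ p ∂μ := by
  rw [transformedMeasure, setLIntegral_map hS (hh.pow_const p) measurable_toTransformed,
    setLIntegral_withDensity_eq_setLIntegral_mul _ (hw.continuous.measurable.pow_const p)
      (g := fun x => h (toTransformed Ω φ x) ^ p)
      ((hh.comp measurable_toTransformed).pow_const p) (measurable_toTransformed hS)]
  simp only [Pi.mul_apply, pullbackDensity, ENNReal.mul_rpow_of_nonneg _ _ hp]

lemma lintegral_transformedMeasure {h : Transformed Ω φ → ℝ≥0∞} (hh : Measurable h) :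
    ∫⁻ y, h y ^ p ∂transformedMeasure Ω φ p μ = ∫⁻ x, pullbackDensity h x ^ p ∂μ := by
  simpa using hw.setLIntegral_transformedMeasure hp μ hh MeasurableSet.univ

lemma modulus_transformedMeasure (Γ : Set (RectifiableCurve (Transformed Ω φ))) :
    modulus p (transformedMeasure Ω φ p μ) Γ = modulus p μ (hw.mapCurve ⁻¹' Γ) := by
  have := hw.borelSpace
  apply le_antisymm
  · refine le_iInf fun ρ => le_iInf fun hρ => le_iInf fun h1 => ?_
    rw [measurable_borel_iff] at hρ
    have hρ' := hw.measurable_pushforwardDensity hρ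
    refine iInf_le_of_le (pushforwardDensity φ ρ) (iInf_le_of_le (measurable_borel_iff.2 hρ')
      (iInf_le_of_le (fun γ hγ => ?_) ?_))
    · rw [← hw.lineIntegral_comapCurve]
      exact h1 _ hγ
    · rw [hw.lintegral_transformedMeasure hp μ hρ', hw.pullbackDensity_pushforwardDensity]
  · refine le_iInf fun ρ => le_iInf fun hρ => le_iInf fun h1 => ?_
    rw [measurable_borel_iff] at hρ
    refine iInf_le_of_le (pullbackDensity ρ) (iInf_le_of_le
      (measurable_borel_iff.2 (hw.measurable_pullbackDensity hρ))
      (iInf_le_of_le (fun γ hγ => ?_) ?_))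
    · exact (h1 _ hγ).trans_eq (hw.lineIntegral_mapCurve γ ρ)
    · rw [hw.lintegral_transformedMeasure hp μ hρ]

lemma isWeakUpperGradient_iff (u : Ω → ℝ) (h : Transformed Ω φ → ℝ≥0∞) :
    IsWeakUpperGradient p (transformedMeasure Ω φ p μ) (u ∘ (toTransformed Ω φ).symm) h ↔
      IsWeakUpperGradient p μ u (pullbackDensity h) := by
  have := hw.borelSpace
  have hmeas : Measurable[borel _] h ↔ Measurable[borel _] (pullbackDensity h) := by
    rw [measurable_borel_iff, measurable_borel_iff]
    refine ⟨hw.measurable_pullbackDensity, fun H => ?_⟩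
    rw [← hw.pushforwardDensity_pullbackDensity h]
    exact hw.measurable_pushforwardDensity H
  rw [IsWeakUpperGradient, IsWeakUpperGradient, hmeas, hw.modulus_transformedMeasure hp]
  refine and_congr_right fun _ => Eq.congr (congrArg _ (Set.ext fun γ => ?_)) rfl
  refine and_congr (hw.nonConstant_mapCurve γ) (not_congr ?_)
  rw [hw.lineIntegral_mapCurve]
  exact Iff.rfl

lemma memDirichlet_iff (u : Ω → ℝ) :
    MemDirichlet p (transformedMeasure Ω φ p μ) (u ∘ (toTransformed Ω φ).symm) ↔
      MemDirichlet p μ u := by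
  have := hw.borelSpace
  constructor
  · rintro ⟨h, hh, hfin⟩
    refine ⟨_, (hw.isWeakUpperGradient_iff hp μ u h).1 hh, ?_⟩
    rwa [← hw.lintegral_transformedMeasure hp μ (measurable_borel_iff.1 hh.1)]
  · rintro ⟨g, hg, hfin⟩
    rw [← hw.pullbackDensity_pushforwardDensity g] at hg hfin
    have hg' := (hw.isWeakUpperGradient_iff hp μ u _).2 hg
    refine ⟨_, hg', ?_⟩
    rwa [hw.lintegral_transformedMeasure hp μ (measurable_borel_iff.1 hg'.1)]

lemma isMinimalWeakUpperGradient_iff (u : Ω → ℝ) (h : Transformed Ω φ → ℝ≥0∞) :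
    IsMinimalWeakUpperGradient p (transformedMeasure Ω φ p μ) (u ∘ (toTransformed Ω φ).symm) h ↔
      IsMinimalWeakUpperGradient p μ u (pullbackDensity h) := by
  have := hw.borelSpace
  have henergy : ∀ k, IsWeakUpperGradient p (transformedMeasure Ω φ p μ)
      (u ∘ (toTransformed Ω φ).symm) k → ∫⁻ y, k y ^ p ∂transformedMeasure Ω φ p μ =
        ∫⁻ x, pullbackDensity k x ^ p ∂μ := fun k hk =>
    hw.lintegral_transformedMeasure hp μ (measurable_borel_iff.1 hk.1)
  constructor
  · rintro ⟨h1, h2, h3⟩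
    refine ⟨(hw.isWeakUpperGradient_iff hp μ u h).1 h1, henergy h h1 ▸ h2, fun k hk => ?_⟩
    rw [← hw.pullbackDensity_pushforwardDensity k] at hk ⊢
    have hk' := (hw.isWeakUpperGradient_iff hp μ u _).2 hk
    rw [← henergy h h1, ← henergy _ hk']
    exact h3 _ hk'
  · rintro ⟨h1, h2, h3⟩
    have h1' := (hw.isWeakUpperGradient_iff hp μ u h).2 h1
    refine ⟨h1', (henergy h h1').symm ▸ h2, fun k hk => ?_⟩
    rw [henergy h h1', henergy k hk]
    exact h3 _ ((hw.isWeakUpperGradient_iff hp μ u k).1 hk)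

/-! ### Invariance of `p`-harmonicity -/

omit hp [MeasurableSpace Ω] [BorelSpace Ω] in
lemma tsupport_comp_symm (v : Ω → ℝ) :
    toTransformed Ω φ ⁻¹' tsupport (v ∘ (toTransformed Ω φ).symm) = tsupport v := by
  have := tsupport_comp_eq_preimage v hw.homeomorph.symm
  change toTransformed Ω φ ⁻¹' tsupport (v ∘ hw.homeomorph.symm) = _
  rw [this]
  ext x
  exact Iff.rfl

omit hp [MeasurableSpace Ω] [BorelSpace Ω] in
lemma hasCompactSupport_comp_symm_iff (v : Ω → ℝ) :
    HasCompactSupport (v ∘ (toTransformed Ω φ).symm) ↔ HasCompactSupport v := by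
  rw [HasCompactSupport, HasCompactSupport, ← hw.tsupport_comp_symm v]
  exact (hw.homeomorph.isCompact_preimage).symm

lemma isPMinimizer_iff (u : Ω → ℝ) :
    IsPMinimizer p (transformedMeasure Ω φ p μ) (u ∘ (toTransformed Ω φ).symm) ↔
      IsPMinimizer p μ u := by
  have := hw.borelSpace
  have henergy : ∀ (v w : Ω → ℝ) k, IsMinimalWeakUpperGradient p (transformedMeasure Ω φ p μ)
      (w ∘ (toTransformed Ω φ).symm) k →
      ∫⁻ y in tsupport (v ∘ (toTransformed Ω φ).symm), k y ^ p ∂transformedMeasure Ω φ p μ =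
        ∫⁻ x in tsupport v, pullbackDensity k x ^ p ∂μ := fun v w k hk => by
    rw [hw.setLIntegral_transformedMeasure hp μ
      (measurable_borel_iff.1 hk.isWeakUpperGradient.1) (isClosed_tsupport _).measurableSet,
      hw.tsupport_comp_symm]
  constructor
  · rintro ⟨h1, h2⟩
    refine ⟨(hw.memDirichlet_iff hp μ u).1 h1, fun v hv hc g h hg hh => ?_⟩
    rw [← hw.pullbackDensity_pushforwardDensity g] at hg ⊢
    rw [← hw.pullbackDensity_pushforwardDensity h] at hh ⊢
    have hg' := (hw.isMinimalWeakUpperGradient_iff hp μ u _).2 hg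
    have hh' := (hw.isMinimalWeakUpperGradient_iff hp μ (u + v) _).2 hh
    rw [← henergy v u _ hg', ← henergy v (u + v) _ hh']
    exact h2 _ ((hw.memDirichlet_iff hp μ v).2 hv) ((hw.hasCompactSupport_comp_symm_iff v).2 hc)
      _ _ hg' hh'
  · rintro ⟨h1, h2⟩
    refine ⟨(hw.memDirichlet_iff hp μ u).2 h1, fun v' hv hc g h hg hh => ?_⟩
    obtain ⟨v, rfl⟩ : ∃ v : Ω → ℝ, v' = v ∘ (toTransformed Ω φ).symm :=
      ⟨v' ∘ toTransformed Ω φ, by funext y; simp⟩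
    have hh' : IsMinimalWeakUpperGradient p (transformedMeasure Ω φ p μ)
      ((u + v) ∘ (toTransformed Ω φ).symm) h := hh
    rw [henergy v u _ hg, henergy v (u + v) _ hh']
    exact h2 _ ((hw.memDirichlet_iff hp μ v).1 hv) ((hw.hasCompactSupport_comp_symm_iff v).1 hc)
      _ _ ((hw.isMinimalWeakUpperGradient_iff hp μ u _).1 hg)
      ((hw.isMinimalWeakUpperGradient_iff hp μ (u + v) _).1 hh')

/-- A conformal change of metric and measure with matching exponents preserves `p`-harmonic
functions. -/
lemma isPHarmonic_iff (u : Ω → ℝ) :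
    IsPHarmonic p (transformedMeasure Ω φ p μ) (u ∘ (toTransformed Ω φ).symm) ↔
      IsPHarmonic p μ u := by
  rw [IsPHarmonic, IsPHarmonic, hw.isPMinimizer_iff hp μ]
  exact and_congr_left fun _ => hw.homeomorph.symm.comp_continuous_iff'

end IsConformalWeight

end Pullback

/-! ### Positivity of the weight -/

section Domain

variable {Ω : Type*} [MetricSpace Ω]

lemma domainBoundary_nonempty (h : ¬ CompleteSpace Ω) : (domainBoundary Ω).Nonempty := by
  by_contra hempty
  rw [not_nonempty_iff_eq_empty, domainBoundary, compl_empty_iff] at hempty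
  refine h ((completeSpace_iff_isComplete_range
    (UniformSpace.Completion.isUniformInducing_coe Ω)).2 ?_)
  rw [hempty]
  exact isComplete_univ

/-- A locally compact space is open in its completion. -/
lemma isClosed_domainBoundary [LocallyCompactSpace Ω] : IsClosed (domainBoundary Ω) := by
  rw [domainBoundary, isClosed_compl_iff, isOpen_iff_mem_nhds]
  rintro _ ⟨x, rfl⟩
  obtain ⟨K, hK, hxK⟩ := exists_compact_mem_nhds x
  have hind := (UniformSpace.Completion.isUniformInducing_coe Ω).isInducing
  rw [hind.nhds_eq_comap] at hxK
  obtain ⟨V, hV, hVK⟩ := hxK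
  obtain ⟨W, hWV, hW, hxW⟩ := mem_nhds_iff.1 hV
  filter_upwards [hW.mem_nhds hxW] with z hz
  have hz' := UniformSpace.Completion.denseRange_coe.subset_closure_image_preimage_of_isOpen hW hz
  have hKc : IsClosed (((↑) : Ω → UniformSpace.Completion Ω) '' K) :=
    (hK.image (UniformSpace.Completion.continuous_coe Ω)).isClosed
  have hsub : ((↑) : Ω → UniformSpace.Completion Ω) '' ((↑) ⁻¹' W) ⊆ (↑) '' K :=
    image_mono fun y hy => hVK (hWV hy)
  exact image_subset_range _ _ (closure_minimal hsub hKc hz')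

lemma distBoundary_pos [LocallyCompactSpace Ω] (h : ¬ CompleteSpace Ω) (x : Ω) :
    0 < distBoundary x :=
  (isClosed_domainBoundary.notMem_iff_infDist_pos (domainBoundary_nonempty h)).1
    (not_not.2 (mem_range_self x))

lemma continuous_distBoundary : Continuous (distBoundary : Ω → ℝ) :=
  (Metric.continuous_infDist_pt _).comp (UniformSpace.Completion.continuous_coe Ω)

/-- As `φ ≤ 1`, the quasiconvexity contained in uniformity gives `d_φ ≤ C d`. -/
lemma IsDampening.isConformalWeight [LocallyCompactSpace Ω] [MeasurableSpace Ω]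
    (hcomplete : ¬ CompleteSpace Ω) (huniform : IsUniformDomain Ω) {p : ℝ} {μ : Measure Ω}
    {φ : ℝ → ℝ} (hφ : IsDampening p μ φ) : IsConformalWeight Ω φ where
  continuous := ENNReal.continuous_ofReal.comp
    (hφ.continuousOn.comp_continuous continuous_distBoundary (distBoundary_pos hcomplete))
  pos x := ENNReal.ofReal_pos.2 (hφ.pos _ (distBoundary_pos hcomplete x))
  lipschitz := by
    obtain ⟨C, hC, hcurve⟩ := huniform
    refine ⟨C.toNNReal, fun x y => ?_⟩
    rcases eq_or_ne x y with rfl | hxy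
    · simp
    obtain ⟨γ, rfl, rfl, hlen, -⟩ := hcurve x y hxy
    calc edist (toTransformed Ω φ γ.source) (toTransformed Ω φ γ.target)
        ≤ γ.lineIntegral (dampingWeight Ω φ) := edist_toTransformed_le_lineIntegral γ
      _ ≤ 1 * γ.length := γ.lineIntegral_le_mul_length fun t _ => by
          rw [← ENNReal.ofReal_one]
          exact ENNReal.ofReal_le_ofReal (hφ.le_one _ (distBoundary_pos hcomplete _))
      _ ≤ ENNReal.ofReal (C * dist γ.source γ.target) := by rwa [one_mul]
      _ = C.toNNReal * edist γ.source γ.target := by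
          rw [ENNReal.ofReal_mul (by linarith), edist_dist]; rfl

end Domain

theorem mainTheorem5 {Ω : Type*} [MetricSpace Ω] [MeasurableSpace Ω] [BorelSpace Ω]
    [LocallyCompactSpace Ω] (hcomplete : ¬ CompleteSpace Ω)
    (hunbounded : ¬ Bornology.IsBounded (Set.univ : Set Ω))
    (hboundary : Bornology.IsBounded (domainBoundary Ω)) (huniform : IsUniformDomain Ω)
    (p : ℝ) (hp : 1 ≤ p) (μ : Measure Ω) [μ.Regular] (hdoubling : IsDoubling μ)
    (hpoincare : SubWhitneyPoincare p μ) (φ : ℝ → ℝ) (hφ : IsDampening p μ φ) (u : Ω → ℝ) :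
    IsPHarmonic p μ u ↔
      IsPHarmonic p (transformedMeasure Ω φ p μ) (u ∘ (toTransformed Ω φ).symm) :=
  ((hφ.isConformalWeight hcomplete huniform).isPHarmonic_iff (zero_le_one.trans hp) μ u).symm
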